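/- Let $\mathfrak R$ be an associative unital topological ring that is separated and complete and in which the open two-sided ideals form a base of neighborhoods of zero. For a set $X$, let $\mathfrak R[[X]]$ be the set of formal linear combinations $\sum_{x\in X}a_xx$ whose families of coefficients converge to zero (for every neighborhood $U$ of zero in $\mathfrak R$, one has $a_x\in U$ for all but finitely many $x$); the functor $X\mapsto\mathfrak R[[X]]$ is a monad on the category of sets, with the unit $x\mapsto 1\cdot x$ and the "opening of parentheses" as multiplication. A left $\mathfrak R$-contramodule is an algebra $\mathfrak C$, $\pi_{\mathfrak C}\colon\mathfrak R[[\mathfrak C]]\to\mathfrak C$ over this monad; these form an abelian category $\mathfrak R\text{-contra}$. A right $\mathfrak R$-module $\mathcal N$ is discrete if the annihilator of each of its elements is open in $\mathfrak R$. For a discrete right module $\mathcal N$ and a left contramodule $\mathfrak C$, let $\mathcal N\odot_{\mathfrak R}\mathfrak C$ be the cokernel of the difference of the two maps $\mathcal N\otimes_{\mathbb Z}\mathfrak R[[\mathfrak C]]\rightrightarrows\mathcal N\otimes_{\mathbb Z}\mathfrak C$ given by $b\otimes\sum_c r_cc\mapsto b\otimes\pi_{\mathfrak C}(\sum_c r_cc)$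 and $b\otimes\sum_c r_cc\mapsto\sum_c br_c\otimes c$. Let $\mathrm{Ctrtor}^{\mathfrak R}_i(\mathcal N,\mathfrak C)=H_i(\mathcal N\odot_{\mathfrak R}\mathfrak P_\bullet)$, where $\mathfrak P_\bullet$ is a projective resolution of $\mathfrak C$ in $\mathfrak R\text{-contra}$. A left contramodule $\mathfrak F$ is $1$-strictly flat if $\mathrm{Ctrtor}^{\mathfrak R}_1(\mathcal N,\mathfrak F)=0$ for all discrete right $\mathfrak R$-modules $\mathcal N$. A projective cover of $\mathfrak F$ is an epimorphism $p\colon\mathfrak P\to\mathfrak F$ in $\mathfrak R\text{-contra}$ with $\mathfrak P$ projective such that every endomorphism $e$ of $\mathfrak P$ with $pe=p$ is an automorphism. Let $\mathfrak F$ be a $1$-strictly flat left $\mathfrak R$-contramodule, and let $p\colon\mathfrak P\to\mathfrak F$ be a projective cover of $\mathfrak F$ in $\mathfrak R\text{-contra}$. Then $p$ is an isomorphism, and the $\mathfrak R$-contramodule $\mathfrak F\cong\mathfrak P$ is projective. -/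

import Mathlib

open Filter Topology TensorProduct CategoryTheory

universe u v w

set_option linter.unusedSectionVars false

namespace Contra

noncomputable section

/-! ## Convergent formal linear combinations

`R` is a complete, separated topological ring in which the open right ideals form a base of
neighbourhoods of zero.  (A topological abelian group carries exactly one uniformity compatible
with the addition, so `[UniformSpace R] [IsUniformAddGroup R]` is no additional datum;
`IsLinearTopology Rᵐᵒᵖ R` says that the open right ideals are a base at zero.) -/

section FormalSums

variable (R : Type u) [Ring R] [UniformSpace R] [IsUniformAddGroup R] [IsTopologicalRing R]
  [CompleteSpace R] [T2Space R] [IsLinearTopology Rᵐᵒᵖ R]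

/-- The group `R[[X]]` of formal linear combinations `∑ aₓ x` whose coefficients form a family
converging to zero: every neighbourhood of zero contains all but finitely many of them. -/
def FormalSum (X : Type v) : AddSubgroup (X → R) where
  carrier := {a | Tendsto a cofinite (𝓝 0)}
  zero_mem' := tendsto_const_nhds
  add_mem' {a b} ha hb := by
    have h : Tendsto (fun x => a x + b x) cofinite (𝓝 (0 + 0)) := Tendsto.add ha hb
    rw [add_zero] at h
    exact h
  neg_mem' {a} ha := by
    have h : Tendsto (fun x => -a x) cofinite (𝓝 (-0)) := Tendsto.neg ha
    rw [neg_zero] at h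
    exact h

variable {R}

theorem tendsto_iff {ι : Type*} {f : ι → R} : Tendsto f cofinite (𝓝 0) ↔
    ∀ I : Submodule Rᵐᵒᵖ R, IsOpen (I : Set R) → {i | f i ∉ I}.Finite := by
  rw [(IsLinearTopology.hasBasis_open_submodule (M := R) Rᵐᵒᵖ).tendsto_right_iff]
  rfl

theorem FormalSum.finite {X : Type v} (a : FormalSum R X) (I : Submodule Rᵐᵒᵖ R)
    (hI : IsOpen (I : Set R)) : {x | a.1 x ∉ I}.Finite := tendsto_iff.1 a.2 I hI

theorem summable_of_tendsto {ι : Type*} {f : ι → R} (hf : Tendsto f cofinite (𝓝 0)) :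
    Summable f := by
  have : NonarchimedeanAddGroup R := ⟨fun U hU => by
    obtain ⟨I, hI, hIU⟩ := (IsLinearTopology.hasBasis_open_submodule (M := R) Rᵐᵒᵖ).mem_iff.1 hU
    exact ⟨⟨I.toAddSubgroup, hI⟩, hIU⟩⟩
  exact NonarchimedeanAddGroup.summable_of_tendsto_cofinite_zero hf

theorem FormalSum.summable {X : Type v} (a : FormalSum R X) : Summable a.1 :=
  summable_of_tendsto a.2

theorem tsum_mem_of_isOpen (I : Submodule Rᵐᵒᵖ R) (hI : IsOpen (I : Set R)) {ι : Type*}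
    {f : ι → R} (h : ∀ i, f i ∈ I) : ∑' i, f i ∈ I :=
  _root_.tsum_mem (s := I.toAddSubgroup)
    (AddSubgroup.isClosed_of_isOpen I.toAddSubgroup hI) h

/-- Summing a null double family over one variable gives a null family. -/
theorem tendsto_tsum {ι : Type*} {κ : Type*} {F : ι × κ → R} (hF : Tendsto F cofinite (𝓝 0)) :
    Tendsto (fun k => ∑' i, F (i, k)) cofinite (𝓝 0) := by
  refine tendsto_iff.2 fun I hI => ((tendsto_iff.1 hF I hI).image Prod.snd).subset ?_
  intro k hk
  by_contra h
  refine hk (tsum_mem_of_isOpen I hI fun i => ?_)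
  by_contra h'
  exact h ⟨(i, k), h', rfl⟩

/-- If `a` is a null family and every `g x` is one, then `(x, y) ↦ aₓ · (g x)_y` is one. -/
theorem tendsto_mul {ι : Type*} {κ : Type*} {a : ι → R} (ha : Tendsto a cofinite (𝓝 0))
    {g : ι → κ → R} (hg : ∀ i, Tendsto (g i) cofinite (𝓝 0)) :
    Tendsto (fun p : ι × κ => a p.1 * g p.1 p.2) cofinite (𝓝 0) := by
  refine tendsto_iff.2 fun I hI => ?_
  have hfin := tendsto_iff.1 ha I hI
  have hi : ∀ i, {k | a i * g i k ∉ I}.Finite := fun i => by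
    have h : Tendsto (fun k => a i * g i k) cofinite (𝓝 (a i * 0)) := (hg i).const_mul (a i)
    rw [mul_zero] at h
    exact tendsto_iff.1 h I hI
  refine (hfin.biUnion fun i _ => (hi i).image (Prod.mk i)).subset ?_
  rintro ⟨i, k⟩ h
  simp only [Set.mem_iUnion]
  refine ⟨i, fun hmem => h ?_, k, h, rfl⟩
  exact I.smul_mem (MulOpposite.op (g i k)) hmem

/-! ## The monad `X ↦ R[[X]]` -/

/-- The monad unit `X → R[[X]]`, sending `x` to the formal linear combination `1 x`. -/
def point {X : Type v} (x : X) : FormalSum R X := by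
  classical
  exact ⟨Pi.single x 1, tendsto_iff.2 fun I _ => (Set.finite_singleton x).subset fun y hy => by
    by_contra h
    exact hy (by rw [Pi.single_eq_of_ne h]; exact I.zero_mem)⟩

/-- The map `R[[f]] : R[[X]] → R[[Y]]`, `∑ aₓ x ↦ ∑_y (∑_{f x = y} aₓ) y`. -/
def map {X : Type v} {Y : Type w} (f : X → Y) (a : FormalSum R X) : FormalSum R Y :=
  ⟨fun y => ∑' x : {x // f x = y}, a.1 x, tendsto_iff.2 fun I hI =>
    ((FormalSum.finite a I hI).image f).subset fun y hy => by
      by_contra h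
      refine hy (tsum_mem_of_isOpen I hI fun x => ?_)
      by_contra h'
      exact h ⟨x.1, h', x.2⟩⟩

/-- Substitution of formal linear combinations into a formal linear combination,
`∑ aₓ x ↦ ∑_y (∑_x aₓ (g x)_y) y`. -/
def bind {X : Type v} {Y : Type w} (a : FormalSum R X) (g : X → FormalSum R Y) :
    FormalSum R Y :=
  ⟨fun y => ∑' x, a.1 x * (g x).1 y, tendsto_tsum (tendsto_mul a.2 fun x => (g x).2)⟩

/-- The monad multiplication `R[[R[[X]]]] → R[[X]]` ("opening of parentheses"):
the coefficient of `∑ r_y y` at `x` is `∑_y r_y y_x`. -/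
def join {X : Type v} (r : FormalSum R (FormalSum R X)) : FormalSum R X :=
  ⟨fun x => ∑' y : FormalSum R X, r.1 y * y.1 x, tendsto_tsum (tendsto_mul r.2 fun y => y.2)⟩

theorem join_eq_bind {X : Type v} (r : FormalSum R (FormalSum R X)) : join r = bind r id := rfl

theorem point_apply_self {X : Type v} (x : X) : (point (R := R) x).1 x = 1 := by
  classical
  simp [point]

theorem point_apply_ne {X : Type v} {x y : X} (h : y ≠ x) : (point (R := R) x).1 y = 0 := by
  classical
  simp [point, h]

theorem map_eq_bind {X : Type v} {Y : Type w} (f : X → Y) (a : FormalSum R X) :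
    map f a = bind a fun x => point (f x) := by
  refine Subtype.ext (funext fun y => ?_)
  change ∑' x : {x | f x = y}, a.1 x = ∑' x, a.1 x * (point (f x)).1 y
  rw [tsum_subtype {x | f x = y} a.1]
  refine tsum_congr fun x => ?_
  by_cases h : f x = y
  · rw [Set.indicator_of_mem (by exact h), h, point_apply_self, mul_one]
  · rw [Set.indicator_of_notMem (by exact h), point_apply_ne (Ne.symm h), mul_zero]

theorem point_bind {X : Type v} {Y : Type w} (x : X) (g : X → FormalSum R Y) :
    bind (point x) g = g x := by
  refine Subtype.ext (funext fun y => ?_)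
  change ∑' x', (point x).1 x' * (g x').1 y = _
  rw [tsum_eq_single x fun x' h => by rw [point_apply_ne h, zero_mul], point_apply_self, one_mul]

theorem bind_point {X : Type v} (a : FormalSum R X) : bind a point = a := by
  refine Subtype.ext (funext fun y => ?_)
  change ∑' x', a.1 x' * (point x').1 y = _
  rw [tsum_eq_single y fun x' h => by rw [point_apply_ne h.symm, mul_zero], point_apply_self,
    mul_one]

theorem bind_bind {X : Type*} {Y : Type*} {Z : Type*} (a : FormalSum R X)
    (g : X → FormalSum R Y) (h : Y → FormalSum R Z) :
    bind (bind a g) h = bind a fun x => bind (g x) h := by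
  refine Subtype.ext (funext fun z => ?_)
  have hnull := tendsto_mul a.2 (fun x => (g x).2)
  have key : Tendsto (fun p : (X × Y) × Z => (a.1 p.1.1 * (g p.1.1).1 p.1.2) * (h p.1.2).1 p.2)
      cofinite (𝓝 0) := tendsto_mul hnull fun p => (h p.2).2
  have key2 : Tendsto (fun p : X × Y => (a.1 p.1 * (g p.1).1 p.2) * (h p.2).1 z)
      cofinite (𝓝 0) :=
    key.comp (Function.Injective.tendsto_cofinite (f := fun p : X × Y => (p, z))
      fun p q hpq => congrArg Prod.fst hpq)
  have hs : Summable (Function.uncurry fun (x : X) (y : Y) =>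
      a.1 x * (g x).1 y * (h y).1 z) := summable_of_tendsto key2
  have hy : ∀ y, Summable fun x => a.1 x * (g x).1 y := fun y => summable_of_tendsto
    (hnull.comp (Function.Injective.tendsto_cofinite (f := fun x : X => (x, y))
      fun p q hpq => congrArg Prod.fst hpq))
  have hx : ∀ x, Summable fun y => (g x).1 y * (h y).1 z := fun x => summable_of_tendsto
    ((tendsto_mul (g x).2 fun y => (h y).2).comp
      (Function.Injective.tendsto_cofinite (f := fun y : Y => (y, z))
        fun p q hpq => congrArg Prod.fst hpq))
  change ∑' y, (∑' x, a.1 x * (g x).1 y) * (h y).1 z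
    = ∑' x, a.1 x * ∑' y, (g x).1 y * (h y).1 z
  calc ∑' y, (∑' x, a.1 x * (g x).1 y) * (h y).1 z
      = ∑' y, ∑' x, a.1 x * (g x).1 y * (h y).1 z :=
        tsum_congr fun y => ((hy y).tsum_mul_right _).symm
    _ = ∑' x, ∑' y, a.1 x * (g x).1 y * (h y).1 z := hs.tsum_comm
    _ = _ := tsum_congr fun x => by
        rw [← (hx x).tsum_mul_left]
        simp only [mul_assoc]

theorem bind_add {X : Type v} {Y : Type w} (a b : FormalSum R X) (g : X → FormalSum R Y) :
    bind (a + b) g = bind a g + bind b g := by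
  refine Subtype.ext (funext fun y => ?_)
  have hs : ∀ c : FormalSum R X, Summable fun x => c.1 x * (g x).1 y := fun c =>
    summable_of_tendsto ((tendsto_mul c.2 fun x => (g x).2).comp
      (Function.Injective.tendsto_cofinite (f := fun x : X => (x, y))
        fun p q hpq => congrArg Prod.fst hpq))
  change ∑' x, (a.1 x + b.1 x) * (g x).1 y
    = ∑' x, a.1 x * (g x).1 y + ∑' x, b.1 x * (g x).1 y
  rw [← (hs a).tsum_add (hs b)]
  simp only [add_mul]

theorem bind_sub_right {X : Type v} {Y : Type w} (a : FormalSum R X) (g h : X → FormalSum R Y) :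
    bind a (fun x => g x - h x) = bind a g - bind a h := by
  refine Subtype.ext (funext fun y => ?_)
  have hs : ∀ g : X → FormalSum R Y, Summable fun x => a.1 x * (g x).1 y := fun g =>
    summable_of_tendsto ((tendsto_mul a.2 fun x => (g x).2).comp
      (Function.Injective.tendsto_cofinite (f := fun x : X => (x, y))
        fun p q hpq => congrArg Prod.fst hpq))
  change ∑' x, a.1 x * ((g x).1 y - (h x).1 y)
    = ∑' x, a.1 x * (g x).1 y - ∑' x, a.1 x * (h x).1 y
  rw [← (hs g).tsum_sub (hs h)]
  simp only [mul_sub]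

theorem map_id {X : Type v} (a : FormalSum R X) : map id a = a := by
  rw [map_eq_bind]
  exact bind_point a

theorem map_map {X : Type*} {Y : Type*} {Z : Type*} (g : Y → Z) (f : X → Y)
    (a : FormalSum R X) : map g (map f a) = map (g ∘ f) a := by
  simp only [map_eq_bind, bind_bind, point_bind, Function.comp_apply]

theorem map_point {X : Type v} {Y : Type w} (f : X → Y) (x : X) :
    map f (point (R := R) x) = point (f x) := by
  rw [map_eq_bind, point_bind]

theorem map_add {X : Type v} {Y : Type w} (f : X → Y) (a b : FormalSum R X) :
    map f (a + b) = map f a + map f b := by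
  simp only [map_eq_bind, bind_add]

theorem map_neg {X : Type v} {Y : Type w} (f : X → Y) (a : FormalSum R X) :
    map f (-a) = -map f a :=
  _root_.map_neg (AddMonoidHom.mk' (map (R := R) f) (map_add f)) a

theorem map_zero {X : Type v} {Y : Type w} (f : X → Y) :
    map f (0 : FormalSum R X) = 0 :=
  _root_.map_zero (AddMonoidHom.mk' (map (R := R) f) (map_add f))

theorem map_bind {X : Type*} {Y : Type*} {Z : Type*} (f : Y → Z) (a : FormalSum R X)
    (g : X → FormalSum R Y) : map f (bind a g) = bind a fun x => map f (g x) := by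
  simp only [map_eq_bind, bind_bind]

theorem join_map {X : Type v} {Y : Type w} (g : X → FormalSum R Y) (a : FormalSum R X) :
    join (map g a) = bind a g := by
  simp only [join_eq_bind, map_eq_bind, bind_bind, point_bind, id]

theorem join_point {X : Type v} (a : FormalSum R X) : join (point a) = a := by
  rw [join_eq_bind, point_bind, id]

theorem join_add {X : Type v} (r s : FormalSum R (FormalSum R X)) :
    join (r + s) = join r + join s := by
  simp only [join_eq_bind, bind_add]

theorem join_join {X : Type v} (r : FormalSum R (FormalSum R (FormalSum R X))) :
    join (join r) = join (map join r) := by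
  rw [join_map, join_eq_bind (join r), join_eq_bind r, bind_bind]
  rfl

end FormalSums

/-! ## Contramodules -/

section Contramodules

variable (R : Type u) [Ring R] [UniformSpace R] [IsUniformAddGroup R] [IsTopologicalRing R]
  [CompleteSpace R] [T2Space R] [IsLinearTopology Rᵐᵒᵖ R]

/-- A left `R`-contramodule: an algebra over the monad `X ↦ R[[X]]` on the category of sets,
that is, a set with a contraaction map satisfying contraunitality and contraassociativity. -/
structure Contramodule where
  /-- the underlying set -/
  carrier : Type u
  /-- the contraaction map -/
  contra : FormalSum R carrier → carrier
  contra_point : ∀ c, contra (point c) = c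
  contra_join : ∀ r : FormalSum R (FormalSum R carrier),
    contra (join r) = contra (map contra r)

instance : CoeSort (Contramodule R) (Type u) := ⟨Contramodule.carrier⟩

variable {R}

/-- Morphisms of contramodules: maps commuting with the contraaction. -/
@[ext]
structure Hom (C D : Contramodule R) where
  /-- the underlying map -/
  toFun : C → D
  map_contra : ∀ r : FormalSum R C, toFun (C.contra r) = D.contra (map toFun r)

/-- The category `R-contra` of left `R`-contramodules. -/
instance : Category (Contramodule R) where
  Hom := Hom
  id C := ⟨id, fun r => by rw [map_id, id]⟩
  comp f g := ⟨g.toFun ∘ f.toFun, fun r => by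
    rw [Function.comp_apply, f.map_contra, g.map_contra, map_map]⟩

@[ext]
theorem hom_ext {C D : Contramodule R} {f g : C ⟶ D} (h : ∀ c, f.toFun c = g.toFun c) : f = g :=
  Hom.ext (funext h)

theorem comp_toFun {C D E : Contramodule R} (f : C ⟶ D) (g : D ⟶ E) (c : C) :
    (f ≫ g).toFun c = g.toFun (f.toFun c) := rfl

theorem id_toFun {C : Contramodule R} (c : C) : Hom.toFun (𝟙 C) c = c := rfl

namespace Contramodule

variable (C : Contramodule R)

theorem contra_add (a b : FormalSum R C) :
    C.contra (a + b) = C.contra (point (C.contra a) + point (C.contra b)) := by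
  have h := C.contra_join (point a + point b)
  rwa [join_add, join_point, join_point, map_add, map_point, map_point] at h

instance : Add C := ⟨fun c d => C.contra (point c + point d)⟩

instance : Zero C := ⟨C.contra 0⟩

instance : Neg C := ⟨fun c => C.contra (-point c)⟩

/-- The underlying abelian group of a contramodule: sums are given by the contraaction on
finite formal linear combinations, `c + d = π(1 c + 1 d)`, `0 = π(0)` and `-c = π((-1) c)`. -/
instance : AddCommGroup C where
  add_assoc a b c := by
    change C.contra (point (C.contra (point a + point b)) + point c)
      = C.contra (point a + point (C.contra (point b + point c)))
    have h1 := C.contra_add (point a + point b) (point c)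
    have h2 := C.contra_add (point a) (point b + point c)
    rw [C.contra_point] at h1 h2
    rw [← h1, ← h2, add_assoc]
  zero_add a := by
    change C.contra (point (C.contra 0) + point a) = a
    have h := C.contra_add 0 (point a)
    rw [C.contra_point] at h
    rw [← h, zero_add, C.contra_point]
  add_zero a := by
    change C.contra (point a + point (C.contra 0)) = a
    have h := C.contra_add (point a) 0
    rw [C.contra_point] at h
    rw [← h, add_zero, C.contra_point]
  neg_add_cancel a := by
    change C.contra (point (C.contra (-point a)) + point a) = C.contra 0
    have h := C.contra_add (-point a) (point a)
    rw [C.contra_point] at h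
    rw [← h, neg_add_cancel]
  add_comm a b := by
    change C.contra (point a + point b) = C.contra (point b + point a)
    rw [add_comm]
  nsmul := nsmulRec
  zsmul := zsmulRec

theorem add_def (c d : C) : c + d = C.contra (point c + point d) := rfl

/-- The contraaction as a group homomorphism. -/
def contraHom : FormalSum R C →+ C := AddMonoidHom.mk' C.contra C.contra_add

theorem contra_sub (a b : FormalSum R C) : C.contra (a - b) = C.contra a - C.contra b :=
  _root_.map_sub C.contraHom a b

theorem contra_zero : C.contra 0 = 0 := rfl

variable {C}

theorem contra_map_sub {X : Type u} (g h : X → C) (a : FormalSum R X) :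
    C.contra (map (fun x => g x - h x) a) = C.contra (map g a) - C.contra (map h a) := by
  have h1 : (fun x => g x - h x) = C.contra ∘ fun x => point (g x) - point (h x) := by
    funext x
    rw [Function.comp_apply, contra_sub, C.contra_point, C.contra_point]
  rw [h1, ← map_map, ← C.contra_join, join_map, bind_sub_right, ← map_eq_bind, ← map_eq_bind,
    contra_sub]

theorem contra_map_zero {X : Type u} (a : FormalSum R X) :
    C.contra (map (fun _ => (0 : C)) a) = 0 := by
  have h := contra_map_sub (C := C) (fun _ : X => (0 : C)) (fun _ => 0) a
  simpa only [sub_self] using h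

end Contramodule

theorem Hom.map_add {C D : Contramodule R} (f : Hom C D) (a b : C) :
    f.toFun (a + b) = f.toFun a + f.toFun b := by
  rw [Contramodule.add_def, f.map_contra, Contra.map_add, map_point, map_point]
  rfl

/-- The additive map underlying a contramodule morphism. -/
def Hom.toAddHom {C D : Contramodule R} (f : Hom C D) : C →+ D :=
  AddMonoidHom.mk' f.toFun f.map_add

/-- The free contramodule `R[[X]]`, with the monad multiplication as contraaction. -/
def free (R : Type u) [Ring R] [UniformSpace R] [IsUniformAddGroup R] [IsTopologicalRing R]
    [CompleteSpace R] [T2Space R] [IsLinearTopology Rᵐᵒᵖ R] (X : Type u) : Contramodule R where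
  carrier := FormalSum R X
  contra := join
  contra_point := join_point
  contra_join := join_join

/-- The morphism `R[[X]] ⟶ C` extending a map of sets `X → C`. -/
def freeLift {X : Type u} {C : Contramodule R} (g : X → C) : free R X ⟶ C where
  toFun a := C.contra (map g a)
  map_contra r := by
    have key : ∀ r : FormalSum R (FormalSum R X),
        C.contra (map g (join r)) = C.contra (map (C.contra ∘ map g) r) := fun r => by
      rw [← map_map, ← C.contra_join, join_map, join_eq_bind, map_bind]
      rfl
    exact key r

theorem freeLift_apply {X : Type u} {C : Contramodule R} (g : X → C) (a : FormalSum R X) :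
    (freeLift g).toFun a = C.contra (map g a) := rfl

theorem freeLift_point {X : Type u} {C : Contramodule R} (g : X → C) (x : X) :
    (freeLift g).toFun (point x) = g x :=
  (freeLift_apply g (point x)).trans (by rw [map_point, C.contra_point])

theorem free_hom_apply {X : Type u} {C : Contramodule R} (f : free R X ⟶ C)
    (a : FormalSum R X) : f.toFun a = C.contra (map (fun x => f.toFun (point x)) a) := by
  have h : a = join (map (point : X → FormalSum R X) a) := by rw [join_map, bind_point]
  have h1 : f.toFun a = f.toFun (join (map (point : X → FormalSum R X) a)) := congrArg f.toFun h
  have h2 := f.map_contra (map (point : X → FormalSum R X) a)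
  have h3 : map f.toFun (map (point : X → FormalSum R X) a) = map (fun x => f.toFun (point x)) a :=
    map_map (X := X) (Y := FormalSum R X) f.toFun point a
  exact h1.trans (h2.trans (congrArg C.contra h3))

/-- Contramodule morphisms that are epimorphisms are surjective: otherwise the projection to the
quotient contramodule by the image would differ from the zero map. -/
theorem surjective_of_epi {A B : Contramodule R} (f : A ⟶ B) [Epi f] :
    Function.Surjective f.toFun := by
  let q : B → B ⧸ f.toAddHom.range := fun b => (b : B ⧸ f.toAddHom.range)
  let t : B ⧸ f.toAddHom.range → B := Quotient.out
  have hqt : ∀ x, q (t x) = x := fun x => Quotient.out_eq x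
  have key : ∀ r : FormalSum R B, q (B.contra (map (t ∘ q) r)) = q (B.contra r) := by
    intro r
    have hmem : ∀ b, ∃ a, f.toFun a = b - t (q b) := fun b => by
      have h : q (t (q b)) = q b := hqt (q b)
      obtain ⟨a, ha⟩ := QuotientAddGroup.eq.1 h
      exact ⟨a, by rw [show f.toFun a = _ from ha, neg_add_eq_sub]⟩
    choose s hs using hmem
    refine QuotientAddGroup.eq.2 ⟨A.contra (map s r), ?_⟩
    change f.toFun (A.contra (map s r)) = _
    rw [neg_add_eq_sub, f.map_contra, map_map]
    have h := Contramodule.contra_map_sub (C := B) id (t ∘ q) r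
    rw [map_id] at h
    rw [← h]
    congr 2
    funext b
    exact hs b
  let Q : Contramodule R :=
    { carrier := B ⧸ f.toAddHom.range
      contra := fun s => q (B.contra (map t s))
      contra_point := fun x => by rw [map_point, B.contra_point, hqt]
      contra_join := fun r => by
        have h1 : B.contra (map t (join r)) = B.contra (map (fun s => B.contra (map t s)) r) := by
          rw [join_eq_bind, map_bind]
          change B.contra (bind r (map t)) = _
          rw [← join_map, B.contra_join, map_map]
          rfl
        rw [h1, ← key, map_map, map_map]
        rfl }
  let π : B ⟶ Q := ⟨q, fun r => by
    change q (B.contra r) = q (B.contra (map t (map q r)))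
    rw [map_map, key]⟩
  let z : B ⟶ Q := ⟨fun _ => q 0, fun r => by
    change q 0 = q (B.contra (map t (map (fun _ => q 0) r)))
    rw [map_map, show t ∘ (fun _ : B => q 0) = (t ∘ q) ∘ (fun _ => (0 : B)) from rfl, ← map_map,
      key, Contramodule.contra_map_zero]⟩
  have hπ : π = z := by
    rw [← cancel_epi f]
    refine hom_ext fun a => ?_
    change q (f.toFun a) = q 0
    exact QuotientAddGroup.eq.2 ⟨-a, by
      rw [_root_.map_neg, add_zero]; rfl⟩
  intro b
  have h : q 0 = q b := (congrArg (fun g : B ⟶ Q => g.toFun b) hπ).symm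
  obtain ⟨a, ha⟩ := QuotientAddGroup.eq.1 h
  exact ⟨a, by rw [show f.toFun a = _ from ha, neg_zero, zero_add]⟩

instance free_projective (X : Type u) : Projective (free R X) where
  factors {E Y} f e _ := by
    have hsurj := surjective_of_epi e
    choose s hs using hsurj
    let g : X → Y := fun x => f.toFun (point x)
    have key : ∀ a : FormalSum R X, e.toFun (E.contra (map (s ∘ g) a)) = Y.contra (map g a) :=
      fun a => by
        rw [e.map_contra, map_map, ← Function.comp_assoc,
          show e.toFun ∘ s = id from funext hs, Function.id_comp]
    exact ⟨freeLift (s ∘ g), hom_ext fun a => (key a).trans (free_hom_apply f a).symm⟩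

/-! ## Projective resolutions -/

/-- A projective resolution `⋯ ⟶ P₂ ⟶ P₁ ⟶ P₀ ⟶ C ⟶ 0`: an exact complex in the category of
contramodules with projective `Pᵢ` (exactness is exactness on underlying abelian groups). -/
structure Resolution (C : Contramodule R) where
  /-- the terms -/
  X : ℕ → Contramodule R
  /-- the differentials -/
  d : ∀ n, X (n + 1) ⟶ X n
  /-- the augmentation -/
  aug : X 0 ⟶ C
  projective : ∀ n, Projective (X n)
  aug_surjective : Function.Surjective aug.toFun
  exact_zero : ∀ x, aug.toFun x = 0 ↔ ∃ y, (d 0).toFun y = x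
  exact_succ : ∀ n x, (d n).toFun x = 0 ↔ ∃ y, (d (n + 1)).toFun y = x

/-- The covering `R[[ker f]] ⟶ B` of the kernel of a morphism `f : B ⟶ D`. -/
def kernelCover {B D : Contramodule R} (f : B ⟶ D) : free R {b : B // f.toFun b = 0} ⟶ B :=
  freeLift Subtype.val

theorem kernelCover_exact {B D : Contramodule R} (f : B ⟶ D) (b : B) :
    f.toFun b = 0 ↔ ∃ y, (kernelCover f).toFun y = b := by
  constructor
  · intro h
    exact ⟨point (⟨b, h⟩ : {b : B // f.toFun b = 0}), freeLift_point _ _⟩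
  · rintro ⟨y, rfl⟩
    have h : f.toFun ∘ (Subtype.val : {b : B // f.toFun b = 0} → B) = fun _ => 0 :=
      funext fun b => b.2
    have key : ∀ a : FormalSum R {b : B // f.toFun b = 0},
        f.toFun (B.contra (map Subtype.val a)) = 0 := fun a => by
      rw [f.map_contra, map_map, h, Contramodule.contra_map_zero]
    exact key y

/-- The stages of the standard free resolution: the `n`-th stage is the morphism from the `n`-th
free term to the preceding term (to `C` if `n = 0`). -/
def standardStage (C : Contramodule R) : ℕ → Σ X Y : Contramodule R, X ⟶ Y
  | 0 => ⟨free R C, C, freeLift id⟩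
  | n + 1 => ⟨_, _, kernelCover (standardStage C n).2.2⟩

/-- The standard free resolution: `P₀ = R[[C]]` with the contraaction `P₀ ⟶ C`, and each `Pₙ₊₁` is
the free contramodule on the set of elements of the kernel of the preceding map. -/
def standardResolution (C : Contramodule R) : Resolution C where
  X n := (standardStage C n).1
  d n := kernelCover (standardStage C n).2.2
  aug := freeLift id
  projective n := by
    cases n
    · exact free_projective _
    · exact free_projective _
  aug_surjective c := ⟨point c, freeLift_point _ _⟩
  exact_zero x := kernelCover_exact (freeLift (C := C) id) x
  exact_succ n x := kernelCover_exact (kernelCover (standardStage C n).2.2) x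

/-! ## Contratensor products with discrete right modules -/

/-- A right `R`-module (a module over `Rᵐᵒᵖ`) is discrete if the annihilator of each of its
elements is open in `R`. -/
class IsDiscreteModule (R : Type u) [Ring R] [TopologicalSpace R] (N : Type v) [AddCommGroup N]
    [Module Rᵐᵒᵖ N] : Prop where
  isOpen_annihilator : ∀ n : N, IsOpen {r : R | MulOpposite.op r • n = 0}

section Contratensor

variable (N : Type u) [AddCommGroup N] [Module Rᵐᵒᵖ N]

theorem finite_support [IsDiscreteModule R N] {X : Type v} (n : N) (a : FormalSum R X) :
    {x | MulOpposite.op (a.1 x) • n ≠ 0}.Finite := by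
  have h : ∀ᶠ x in cofinite, a.1 x ∈ {r : R | MulOpposite.op r • n = 0} :=
    a.2 ((IsDiscreteModule.isOpen_annihilator n).mem_nhds (by simp))
  exact h

/-- `n · ∑ᵢ rᵢ = ∑ᵢ n · rᵢ` for null families in `R` and elements of discrete modules. -/
theorem op_tsum_smul [IsDiscreteModule R N] {ι : Type v} (n : N) (a : ι → R)
    (ha : Tendsto a cofinite (𝓝 0)) :
    MulOpposite.op (∑' i, a i) • n = ∑ᶠ i, MulOpposite.op (a i) • n := by
  have hfin : (Function.support fun i => MulOpposite.op (a i) • n).Finite :=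
    finite_support N n (⟨a, ha⟩ : FormalSum R ι)
  have hs := (summable_of_tendsto ha).hasSum
  have hU : {r : R | MulOpposite.op (r - ∑' i, a i) • n = 0} ∈ 𝓝 (∑' i, a i) := by
    have hc : Continuous fun r : R => r - ∑' i, a i := continuous_id.sub continuous_const
    exact ((IsDiscreteModule.isOpen_annihilator n).preimage hc).mem_nhds (by simp)
  obtain ⟨s, hs'⟩ := ((hs.eventually hU).and
    (eventually_ge_atTop hfin.toFinset)).exists
  obtain ⟨h1, h2⟩ := hs'
  rw [finsum_eq_sum_of_support_subset (s := s) _ fun i hi => h2 (hfin.mem_toFinset.2 hi)]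
  have h3 : MulOpposite.op (∑ i ∈ s, a i - ∑' i, a i) • n = 0 := h1
  rw [MulOpposite.op_sub, sub_smul, sub_eq_zero] at h3
  rw [← h3, Finset.op_sum, Finset.sum_smul]

/-- The image in `N ⊗ C` of the difference of the two maps `N ⊗ R[[C]] ⇉ N ⊗ C`, namely
`n ⊗ ∑ r_c c ↦ n ⊗ π(∑ r_c c)` and `n ⊗ ∑ r_c c ↦ ∑ (n r_c) ⊗ c` (a finite sum, as `N` is
discrete). -/
def contratensorRel (C : Contramodule R) : AddSubgroup (N ⊗[ℤ] C) :=
  AddSubgroup.closure {t | ∃ (n : N) (r : FormalSum R C),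
    t = n ⊗ₜ[ℤ] C.contra r - ∑ᶠ c : C, (MulOpposite.op (r.1 c) • n) ⊗ₜ[ℤ] c}

/-- The contratensor product `N ⊙ C` of a discrete right module and a left contramodule: the
cokernel of the difference of the two maps `N ⊗ R[[C]] ⇉ N ⊗ C`. -/
def Contratensor (C : Contramodule R) : Type u := (N ⊗[ℤ] C) ⧸ contratensorRel N C

instance (C : Contramodule R) : AddCommGroup (Contratensor N C) :=
  inferInstanceAs (AddCommGroup ((N ⊗[ℤ] C) ⧸ contratensorRel N C))

/-- The map `N ⊗ C → N ⊗ D` induced by a contramodule morphism. -/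
def tensorMap {C D : Contramodule R} (f : C ⟶ D) : N ⊗[ℤ] C →+ N ⊗[ℤ] D :=
  (TensorProduct.map LinearMap.id f.toAddHom.toIntLinearMap).toAddMonoidHom

theorem tensorMap_tmul {C D : Contramodule R} (f : C ⟶ D) (n : N) (c : C) :
    tensorMap N f (n ⊗ₜ c) = n ⊗ₜ f.toFun c := rfl

theorem tensorMap_rel [IsDiscreteModule R N] {C D : Contramodule R} (f : C ⟶ D) :
    contratensorRel N C ≤ (contratensorRel N D).comap (tensorMap N f) := by
  refine (AddSubgroup.closure_le _).2 ?_
  rintro _ ⟨n, r, rfl⟩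
  refine AddSubgroup.subset_closure ⟨n, map f.toFun r, ?_⟩
  have hfin : (Function.support fun c : C => MulOpposite.op (r.1 c) • n).Finite :=
    finite_support N n r
  have hfin' : (Function.support fun c : C =>
      (MulOpposite.op (r.1 c) • n) ⊗ₜ[ℤ] c).Finite := hfin.subset fun c hc hc' => hc (by
    change (MulOpposite.op (r.1 c) • n) = 0 at hc'
    simp only [hc', TensorProduct.zero_tmul])
  rw [map_sub, tensorMap_tmul, f.map_contra, (tensorMap N f).map_finsum hfin']
  congr 1
  simp only [tensorMap_tmul]
  have hnull : ∀ d : D, Tendsto (fun c : {c // f.toFun c = d} => r.1 c.1) cofinite (𝓝 0) :=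
    fun d => r.2.comp Subtype.val_injective.tendsto_cofinite
  classical
  have hcoeff : ∀ d : D, (MulOpposite.op ((map f.toFun r).1 d) • n) ⊗ₜ[ℤ] d
      = ∑ c ∈ hfin.toFinset, if f.toFun c = d then (MulOpposite.op (r.1 c) • n) ⊗ₜ[ℤ] d else 0 := by
    intro d
    have h1 : MulOpposite.op ((map f.toFun r).1 d) • n
        = ∑ᶠ c : {c // f.toFun c = d}, MulOpposite.op (r.1 c.1) • n :=
      op_tsum_smul N n _ (hnull d)
    have h2 : (∑ᶠ c : {c // f.toFun c = d}, MulOpposite.op (r.1 c.1) • n)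
        = ∑ c ∈ hfin.toFinset, if f.toFun c = d then MulOpposite.op (r.1 c) • n else 0 := by
      rw [finsum_subtype_eq_finsum_cond (f := fun c => MulOpposite.op (r.1 c) • n)
        (fun c => f.toFun c = d)]
      simp only [finsum_eq_if]
      refine finsum_eq_sum_of_support_subset _ fun c hc => ?_
      rw [Finset.mem_coe, hfin.mem_toFinset]
      intro h0
      exact hc (by simp only [h0, ite_self])
    rw [h1, h2, TensorProduct.sum_tmul]
    refine Finset.sum_congr rfl fun c _ => ?_
    split_ifs
    · rfl
    · exact TensorProduct.zero_tmul _ _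
  simp only [hcoeff]
  rw [finsum_sum_comm]
  · rw [finsum_eq_sum_of_support_subset (s := hfin.toFinset)]
    · refine Finset.sum_congr rfl fun c _ => ?_
      rw [finsum_eq_single _ (f.toFun c) fun d hd => if_neg (Ne.symm hd), if_pos rfl]
    · intro c hc
      rw [Finset.mem_coe, hfin.mem_toFinset]
      intro h0
      exact hc (by simp only [h0, TensorProduct.zero_tmul])
  · intro c _
    refine (Set.finite_singleton (f.toFun c)).subset fun d hd => ?_
    by_contra h
    exact hd (if_neg (Ne.symm h))

/-- The functoriality `N ⊙ f : N ⊙ C → N ⊙ D` of the contratensor product. -/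
def Contratensor.map [IsDiscreteModule R N] {C D : Contramodule R} (f : C ⟶ D) :
    Contratensor N C →+ Contratensor N D :=
  QuotientAddGroup.map _ _ (tensorMap N f) (tensorMap_rel N f)

/-! ## The derived functors of the contratensor product -/

variable [IsDiscreteModule R N]

/-- The cycles in degree `i` of the complex `N ⊙ P`. -/
def Resolution.cycles {C : Contramodule R} (P : Resolution C) :
    (i : ℕ) → AddSubgroup (Contratensor N (P.X i))
  | 0 => ⊤
  | i + 1 => (Contratensor.map N (P.d i)).ker

/-- The homology `H_i(N ⊙ P)`. -/
def Resolution.homology {C : Contramodule R} (P : Resolution C) (i : ℕ) : Type u :=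
  P.cycles N i ⧸ (Contratensor.map N (P.d i)).range.addSubgroupOf (P.cycles N i)

instance {C : Contramodule R} (P : Resolution C) (i : ℕ) : AddCommGroup (P.homology N i) :=
  inferInstanceAs (AddCommGroup
    (P.cycles N i ⧸ (Contratensor.map N (P.d i)).range.addSubgroupOf (P.cycles N i)))

/-- The left derived functor `Ctrtor_i(N, C) = H_i(N ⊙ P)` of the contratensor product in its
contramodule argument, computed by the standard free resolution `P` of `C`. -/
def Ctrtor (C : Contramodule R) (i : ℕ) : Type u := (standardResolution C).homology N i

instance (C : Contramodule R) (i : ℕ) : AddCommGroup (Ctrtor N C i) :=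
  inferInstanceAs (AddCommGroup ((standardResolution C).homology N i))

end Contratensor

/-- A contramodule `F` is `1`-strictly flat if `Ctrtor₁(N, F) = 0` for all discrete right
modules `N`. -/
def IsOneStrictlyFlat (F : Contramodule R) : Prop :=
  ∀ (N : Type u) [AddCommGroup N] [Module Rᵐᵒᵖ N] [IsDiscreteModule R N],
    Subsingleton (Ctrtor N F 1)

end Contramodules

/-! ## Projective covers -/

/-- A projective cover of `F`: an epimorphism `p : P ⟶ F` from a projective object such that every
endomorphism `e` of `P` with `p e = p` is an automorphism. -/
structure IsProjectiveCover {A : Type u} [Category.{v} A] {P F : A} (p : P ⟶ F) : Prop where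
  projective : Projective P
  epi : Epi p
  isIso_of_comp_eq : ∀ e : P ⟶ P, e ≫ p = p → IsIso e

end

end Contra

namespace Contra

noncomputable section

/-! Write `I C` for the sums `∑ iₓ cₓ` in a contramodule `C` with all coefficients in an open right
ideal `I`, and `K` for the kernel of the canonical `q : R[[F]] ⟶ F`. Since `R/J ⊙ C` is `C / J C`,
the vanishing of `Ctrtor₁(R/J, F)` says that `K ∩ J R[[F]]` lies in `J K` (`mem_idealSpan_ker`).

For `a ∈ K`, let `J` be generated by `I` and the finitely many coefficients of `a` outside `I`.
Writing `a` as an element of `J K` gives `cₓ ∈ K` with `a ≡ ∑ aₓ cₓ` modulo `I R[[F]]`, the sum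
being finite (`exists_finite_sum_ker`).

Lift `p` and `q` through each other to `u : P ⟶ R[[F]]` and `v : R[[F]] ⟶ P`. Given `k` with `p k =
0`, apply the above to `a = u k`. Subtracting from `v ∘ u` the map `w ↦ ∑ (u w)ₓ v(cₓ)`, whose
values lie in the kernel of `p`, leaves an endomorphism `e` over `p`, hence an automorphism, and `e
k ∈ I P`. So `k ∈ I P` for every open right ideal `I`. Then all coefficients of `u k` vanish by
separatedness, and `u` is injective because `v ∘ u` is an automorphism. -/

section ContraactionOfIdeals

variable {R : Type u} [Ring R] [UniformSpace R] [IsUniformAddGroup R] [IsTopologicalRing R]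
  [CompleteSpace R] [T2Space R] [IsLinearTopology Rᵐᵒᵖ R]

/-! ### Scalar multiplication on formal sums and the module underlying a contramodule. -/

/-- `R[[f]]` as a homomorphism of groups. -/
def mapHom {X : Type v} {Y : Type w} (f : X → Y) : FormalSum R X →+ FormalSum R Y :=
  AddMonoidHom.mk' (map f) (map_add f)

/-- Left multiplication of all the coefficients by a scalar. -/
def lsmul {X : Type v} (r : R) (a : FormalSum R X) : FormalSum R X :=
  ⟨fun x => r * a.1 x, by
    have h : Tendsto (fun x => r * a.1 x) cofinite (𝓝 (r * 0)) := Tendsto.const_mul r a.2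
    rw [mul_zero] at h
    exact h⟩

theorem bind_lsmul {X : Type v} {Y : Type w} (r : R) (a : FormalSum R X)
    (g : X → FormalSum R Y) : bind (lsmul r a) g = lsmul r (bind a g) := by
  refine Subtype.ext (funext fun y => ?_)
  have hs : Summable fun x => a.1 x * (g x).1 y :=
    summable_of_tendsto ((tendsto_mul a.2 fun x => (g x).2).comp
      (Function.Injective.tendsto_cofinite (f := fun x : X => (x, y))
        fun p q hpq => congrArg Prod.fst hpq))
  change ∑' x, r * a.1 x * (g x).1 y = r * ∑' x, a.1 x * (g x).1 y
  rw [← hs.tsum_mul_left]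
  simp only [mul_assoc]

theorem map_lsmul {X : Type v} {Y : Type w} (f : X → Y) (r : R) (a : FormalSum R X) :
    map f (lsmul r a) = lsmul r (map f a) := by
  simp only [map_eq_bind, bind_lsmul]

theorem lsmul_add {X : Type v} (r : R) (a b : FormalSum R X) :
    lsmul r (a + b) = lsmul r a + lsmul r b :=
  Subtype.ext (funext fun _ => mul_add _ _ _)

theorem add_lsmul {X : Type v} (r s : R) (a : FormalSum R X) :
    lsmul (r + s) a = lsmul r a + lsmul s a :=
  Subtype.ext (funext fun _ => add_mul _ _ _)

theorem mul_lsmul {X : Type v} (r s : R) (a : FormalSum R X) :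
    lsmul (r * s) a = lsmul r (lsmul s a) :=
  Subtype.ext (funext fun _ => mul_assoc _ _ _)

theorem one_lsmul {X : Type v} (a : FormalSum R X) : lsmul 1 a = a :=
  Subtype.ext (funext fun _ => one_mul _)

namespace Contramodule

variable {C D : Contramodule R}

instance : SMul R C := ⟨fun r c => C.contra (lsmul r (point c))⟩

theorem smul_def (r : R) (c : C) : r • c = C.contra (lsmul r (point c)) := rfl

/-- Contraassociativity for the one-term formal sum with coefficient `r` at `a`. It reduces the
module axioms to identities between coefficients. -/
theorem smul_contra (r : R) (a : FormalSum R C) : r • C.contra a = C.contra (lsmul r a) := by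
  have h := C.contra_join (lsmul r (point a))
  rw [join_eq_bind, bind_lsmul, point_bind, map_lsmul, map_point] at h
  exact h.symm

/-- The `R`-module underlying a contramodule. -/
instance : Module R C where
  one_smul c := by rw [smul_def, one_lsmul, C.contra_point]
  mul_smul r s c := by rw [smul_def s, smul_contra, smul_def, mul_lsmul]
  smul_add r c d := by
    rw [add_def, smul_contra, lsmul_add]
    exact C.contraHom.map_add _ _
  smul_zero r := by
    rw [← C.contra_zero, smul_contra]
    exact congrArg C.contra (Subtype.ext (funext fun _ => mul_zero _))
  add_smul r s c := by
    rw [smul_def, add_lsmul]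
    exact C.contraHom.map_add _ _
  zero_smul c := by
    rw [← C.contra_zero, smul_def]
    exact congrArg C.contra (Subtype.ext (funext fun _ => zero_mul _))

theorem contra_map_lsmul_point {X : Type v} (g : X → C) (r : R) (x : X) :
    C.contra (map g (lsmul r (point x))) = r • g x := by
  rw [map_lsmul, map_point, smul_def]

end Contramodule

theorem Hom.map_smul {C D : Contramodule R} (f : Hom C D) (r : R) (c : C) :
    f.toFun (r • c) = r • f.toFun c := by
  rw [Contramodule.smul_def, f.map_contra, map_lsmul, map_point, Contramodule.smul_def]

theorem Hom.map_zero {C D : Contramodule R} (f : Hom C D) : f.toFun 0 = 0 :=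
  _root_.map_zero f.toAddHom

theorem Hom.map_sub {C D : Contramodule R} (f : Hom C D) (a b : C) :
    f.toFun (a - b) = f.toFun a - f.toFun b :=
  _root_.map_sub f.toAddHom a b

theorem Hom.map_sum {C D : Contramodule R} (f : Hom C D) {ι : Type*} (s : Finset ι) (c : ι → C) :
    f.toFun (∑ i ∈ s, c i) = ∑ i ∈ s, f.toFun (c i) :=
  _root_.map_sum f.toAddHom c s

/-- The difference of two contramodule morphisms. -/
def Hom.sub {C D : Contramodule R} (f g : C ⟶ D) : C ⟶ D where
  toFun c := f.toFun c - g.toFun c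
  map_contra r := by
    rw [Contramodule.contra_map_sub, f.map_contra, g.map_contra]

/-! ### Sums with coefficients in an open right ideal. -/

/-- Formal linear combinations with coefficients in a right ideal. -/
def FormalSum.coeffIn (J : Submodule Rᵐᵒᵖ R) (X : Type v) : AddSubgroup (FormalSum R X) where
  carrier := {a | ∀ x, a.1 x ∈ J}
  zero_mem' _ := J.zero_mem
  add_mem' ha hb x := J.add_mem (ha x) (hb x)
  neg_mem' ha x := J.neg_mem (ha x)

/-- The subgroup of all the sums `∑ jₓ g(x)` with coefficients in the right ideal `J`. -/
def idealSpan (J : Submodule Rᵐᵒᵖ R) {C : Contramodule R} {X : Type v} (g : X → C) :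
    AddSubgroup C :=
  (FormalSum.coeffIn J X).map (C.contraHom.comp (mapHom g))

theorem map_mem_idealSpan {J : Submodule Rᵐᵒᵖ R} {C D : Contramodule R} (f : C ⟶ D)
    {X : Type v} {g : X → C} {c : C} (h : c ∈ idealSpan J g) :
    f.toFun c ∈ idealSpan J (f.toFun ∘ g) := by
  obtain ⟨a, ha, rfl⟩ := h
  exact ⟨a, ha, ((f.map_contra _).trans (congrArg D.contra (map_map _ _ _))).symm⟩

/-- Collecting terms along the fibres of `f` produces infinite sums of elements of `J`; these stay
in `J` because an open subgroup is closed. -/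
theorem idealSpan_comp_le {J : Submodule Rᵐᵒᵖ R} (hJ : IsOpen (J : Set R)) {C : Contramodule R}
    {X : Type v} {Y : Type w} (g : Y → C) (f : X → Y) : idealSpan J (g ∘ f) ≤ idealSpan J g := by
  rintro _ ⟨a, ha, rfl⟩
  exact ⟨map f a, fun y => tsum_mem_of_isOpen J hJ fun x => ha x.1,
    congrArg C.contra (map_map _ _ _)⟩

theorem idealSpan_le_id {J : Submodule Rᵐᵒᵖ R} (hJ : IsOpen (J : Set R)) {C : Contramodule R}
    {X : Type v} (g : X → C) : idealSpan J g ≤ idealSpan J (id : C → C) :=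
  idealSpan_comp_le hJ id g

theorem smul_mem_idealSpan {J : Submodule Rᵐᵒᵖ R} {C : Contramodule R} {X : Type v} (g : X → C)
    {r : R} (hr : r ∈ J) (x : X) : r • g x ∈ idealSpan J g :=
  ⟨lsmul r (point x), fun y => J.smul_mem (MulOpposite.op ((point (R := R) x).1 y)) hr,
    Contramodule.contra_map_lsmul_point g r x⟩

/-- A sum `∑ aₓ g(x)` agrees with its finite part modulo the sums with coefficients in `J`. -/
theorem contra_map_sub_sum_mem {J : Submodule Rᵐᵒᵖ R} {C : Contramodule R} {X : Type v}
    (g : X → C) (a : FormalSum R X) (S : Finset X) (hS : ∀ x, a.1 x ∉ J → x ∈ S) :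
    C.contra (map g a) - ∑ x ∈ S, a.1 x • g x ∈ idealSpan J g := by
  classical
  -- The witness is `a` with its coefficients on `S` replaced by zero; those remaining lie in `J` by
  -- `hS`.
  refine ⟨a - ∑ x ∈ S, lsmul (a.1 x) (point x), fun y => ?_, ?_⟩
  · have h : (∑ x ∈ S, lsmul (a.1 x) (point x) : FormalSum R X).1 y
        = if y ∈ S then a.1 y else 0 := by
      rw [AddSubgroup.val_finsetSum, Finset.sum_apply]
      have h2 : ∀ x, (lsmul (a.1 x) (point x) : FormalSum R X).1 y
          = if x = y then a.1 y else 0 := fun x => by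
        change a.1 x * (point x).1 y = _
        split_ifs with hxy
        · rw [hxy, point_apply_self, mul_one]
        · rw [point_apply_ne (Ne.symm hxy), mul_zero]
      simp only [h2, Finset.sum_ite_eq']
    change a.1 y - (∑ x ∈ S, lsmul (a.1 x) (point x) : FormalSum R X).1 y ∈ J
    rw [h]
    split_ifs with hy
    · rw [sub_self]; exact J.zero_mem
    · rw [sub_zero]; exact not_not.1 (mt (hS y) hy)
  · rw [_root_.map_sub, _root_.map_sum]
    exact congrArg₂ _ rfl
      (Finset.sum_congr rfl fun x _ => Contramodule.contra_map_lsmul_point g _ x)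

/-- Opening parentheses multiplies the coefficients in `J` on the right only, so a right ideal,
closed under convergent sums, absorbs the result. -/
theorem coeff_mem_of_mem_idealSpan {J : Submodule Rᵐᵒᵖ R} (hJ : IsOpen (J : Set R)) {X : Type u}
    {a : FormalSum R X} (h : a ∈ idealSpan J (C := free R X) (id : free R X → free R X)) (x : X) :
    a.1 x ∈ J := by
  obtain ⟨b, hb, rfl⟩ := h
  have h : ∀ b : FormalSum R (FormalSum R X), (join (map id b)).1 x = ∑' y, b.1 y * y.1 x :=
    fun b => by rw [map_id]; rfl
  rw [show (((free R X).contraHom.comp (mapHom id)) b : FormalSum R X).1 x = _ from h b]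
  exact tsum_mem_of_isOpen J hJ fun y => J.smul_mem (MulOpposite.op (y.1 x)) (hb y)

theorem eq_zero_of_forall_mem_isOpen {r : R}
    (h : ∀ I : Submodule Rᵐᵒᵖ R, IsOpen (I : Set R) → r ∈ I) : r = 0 := by
  by_contra hr
  obtain ⟨I, hI, hIU⟩ := (IsLinearTopology.hasBasis_open_submodule (M := R) Rᵐᵒᵖ).mem_iff.1
    (isOpen_compl_singleton.mem_nhds (Ne.symm hr) : {r}ᶜ ∈ 𝓝 (0 : R))
  exact hIU (h I hI) rfl

/-! ## Contratensor products with cyclic discrete modules -/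

section Cyclic

variable {J : Submodule Rᵐᵒᵖ R}

/-- The annihilator of the class of `s` is the preimage of `J` under left multiplication by `s`,
which is continuous. -/
theorem isDiscreteModule_quotient (hJ : IsOpen (J : Set R)) : IsDiscreteModule R (R ⧸ J) where
  isOpen_annihilator n := by
    obtain ⟨s, rfl⟩ := Submodule.Quotient.mk_surjective J n
    have h : {r : R | MulOpposite.op r • (Submodule.Quotient.mk s : R ⧸ J) = 0}
        = (fun r => s * r) ⁻¹' (J : Set R) := by
      ext r
      rw [Set.mem_ofPred_eq, ← Submodule.Quotient.mk_smul, Submodule.Quotient.mk_eq_zero]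
      rfl
    rw [h]
    exact hJ.preimage (continuous_const.mul continuous_id)

variable (J) in
/-- The map `C → R/J ⊙ C` sending `c` to `1 ⊙ c`. -/
def oneTensor (C : Contramodule R) : C →+ Contratensor (R ⧸ J) C :=
  AddMonoidHom.mk'
    (fun c => QuotientAddGroup.mk ((Submodule.Quotient.mk (1 : R) : R ⧸ J) ⊗ₜ[ℤ] c))
    fun c d => by rw [TensorProduct.tmul_add]; rfl

theorem op_smul_mk_one (r : R) : MulOpposite.op r • (Submodule.Quotient.mk (1 : R) : R ⧸ J)
    = Submodule.Quotient.mk r := by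
  rw [← Submodule.Quotient.mk_smul, op_smul_eq_mul, one_mul]

theorem oneTensor_contra (C : Contramodule R) (a : FormalSum R C) :
    oneTensor J C (C.contra a)
      = QuotientAddGroup.mk (∑ᶠ c : C, (Submodule.Quotient.mk (a.1 c) : R ⧸ J) ⊗ₜ[ℤ] c) := by
  refine QuotientAddGroup.eq.2 ?_
  rw [← neg_mem_iff, neg_add, neg_neg, ← sub_eq_add_neg]
  refine AddSubgroup.subset_closure ⟨Submodule.Quotient.mk 1, a, ?_⟩
  simp only [op_smul_mk_one]

/-- The defining relation moves the coefficients across the tensor sign, where they die in `R/J`.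
Together with `mem_of_oneTensor_eq_zero` and `oneTensor_surjective` this identifies `R/J ⊙ C` with
`C / J C`. -/
theorem oneTensor_eq_zero_of_mem {C : Contramodule R} {c : C}
    (h : c ∈ idealSpan J (id : C → C)) : oneTensor J C c = 0 := by
  obtain ⟨a, ha, rfl⟩ := h
  change oneTensor J C (C.contra (map id a)) = 0
  rw [map_id, oneTensor_contra]
  simp only [(Submodule.Quotient.mk_eq_zero J).2 (ha _), TensorProduct.zero_tmul, finsum_zero]
  rfl

/-- In the contratensor product, the class of `r ⊗ c` is that of `1 ⊗ r c`. -/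
theorem oneTensor_surjective (C : Contramodule R) : Function.Surjective (oneTensor J C) := by
  intro t
  obtain ⟨t, rfl⟩ := QuotientAddGroup.mk_surjective t
  induction t using TensorProduct.induction_on with
  | zero => exact ⟨0, _root_.map_zero _⟩
  | tmul n c =>
    obtain ⟨r, rfl⟩ := Submodule.Quotient.mk_surjective J n
    refine ⟨r • c, ?_⟩
    rw [Contramodule.smul_def, oneTensor_contra, finsum_eq_single _ c fun d hd => ?_]
    · change QuotientAddGroup.mk (Submodule.Quotient.mk (r * (point c).1 c) ⊗ₜ[ℤ] c) = _
      rw [point_apply_self, mul_one]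
    · change (Submodule.Quotient.mk (r * (point c).1 d) : R ⧸ J) ⊗ₜ[ℤ] d = 0
      rw [point_apply_ne hd, mul_zero, Submodule.Quotient.mk_zero, TensorProduct.zero_tmul]
  | add s t hs ht =>
    obtain ⟨c, hc⟩ := hs
    obtain ⟨d, hd⟩ := ht
    exact ⟨c + d, by rw [_root_.map_add, hc, hd]; rfl⟩

variable (J) in
/-- The map `R/J ⊗ C → C / JC` sending `r ⊗ c` to the class of `r c`. -/
def quotientTensorMap (C : Contramodule R) :
    (R ⧸ J) ⊗[ℤ] C →+ C ⧸ idealSpan J (id : C → C) :=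
  let β : R →+ C →+ C ⧸ idealSpan J (id : C → C) :=
    ((AddMonoidHom.compHom (QuotientAddGroup.mk' (idealSpan J (id : C → C)))).comp
      (smulAddHom R C))
  let γ : (R ⧸ J) →+ C →+ C ⧸ idealSpan J (id : C → C) :=
    QuotientAddGroup.lift J.toAddSubgroup β fun _ hr => AddMonoidHom.ext fun c =>
      (QuotientAddGroup.eq_zero_iff _).2 (smul_mem_idealSpan (id : C → C) hr c)
  TensorProduct.liftAddHom γ fun z n c => by
    rw [_root_.map_zsmul, _root_.map_zsmul, AddMonoidHom.coe_smul, Pi.smul_apply]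

theorem quotientTensorMap_tmul {C : Contramodule R} (r : R) (c : C) :
    quotientTensorMap J C (Submodule.Quotient.mk r ⊗ₜ[ℤ] c) = QuotientAddGroup.mk (r • c) := rfl

/-- For a relation given by the class of `r` and by `a`, only finitely many `r a_c` lie outside `J`.
The discarded part of `∑ (r a_c) c` is in `J C`, so both sides have the same class in `C / J C`. -/
theorem contratensorRel_le_ker (hJ : IsOpen (J : Set R)) (C : Contramodule R) :
    contratensorRel (R ⧸ J) C ≤ (quotientTensorMap J C).ker := by
  have := isDiscreteModule_quotient hJ
  refine (AddSubgroup.closure_le _).2 ?_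
  rintro _ ⟨n, a, rfl⟩
  obtain ⟨r, rfl⟩ := Submodule.Quotient.mk_surjective J n
  have hsmul : ∀ c, MulOpposite.op (a.1 c) • (Submodule.Quotient.mk r : R ⧸ J)
      = Submodule.Quotient.mk ((lsmul r a).1 c) := fun c => rfl
  simp only [hsmul]
  have hfin : {c | (lsmul r a).1 c ∉ J}.Finite := FormalSum.finite (lsmul r a) J hJ
  rw [finsum_eq_sum_of_support_subset (s := hfin.toFinset)]
  · change quotientTensorMap J C _ = 0
    rw [_root_.map_sub, _root_.map_sum]
    simp only [quotientTensorMap_tmul]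
    rw [Contramodule.smul_contra]
    have h := contra_map_sub_sum_mem (J := J) (id : C → C) (lsmul r a) hfin.toFinset
      fun x hx => hfin.mem_toFinset.2 hx
    rw [map_id] at h
    have h2 := (QuotientAddGroup.eq_zero_iff _).2 h
    rw [← h2]
    change _ = QuotientAddGroup.mk' (idealSpan J (id : C → C)) _
    rw [_root_.map_sub, _root_.map_sum]
    rfl
  · intro c hc
    rw [Finset.mem_coe, hfin.mem_toFinset]
    intro h
    exact hc (by simp only [(Submodule.Quotient.mk_eq_zero J).2 h, TensorProduct.zero_tmul])

/-- The map `R/J ⊗ C → C / J C` kills the relations and sends `1 ⊗ c` to the class of `c`. -/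
theorem mem_of_oneTensor_eq_zero (hJ : IsOpen (J : Set R)) {C : Contramodule R} {c : C}
    (h : oneTensor J C c = 0) : c ∈ idealSpan J (id : C → C) := by
  have h1 := contratensorRel_le_ker hJ C ((QuotientAddGroup.eq_zero_iff _).1 h)
  have h2 : (QuotientAddGroup.mk ((1 : R) • c) : C ⧸ idealSpan J (id : C → C)) = 0 := h1
  rw [one_smul] at h2
  exact (QuotientAddGroup.eq_zero_iff _).1 h2

theorem map_oneTensor [IsDiscreteModule R (R ⧸ J)] {C D : Contramodule R} (f : C ⟶ D) (c : C) :
    Contratensor.map (R ⧸ J) f (oneTensor J C c) = oneTensor J D (f.toFun c) := rfl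

/-- If `Ctrtor₁(R/J, F) = 0`, then the kernel `K` of `R[[F]] ⟶ F` meets `J R[[F]]` in `J K`. -/
theorem mem_idealSpan_ker {F : Contramodule R} (hF : IsOneStrictlyFlat F)
    (hJ : IsOpen (J : Set R)) {y : free R F} (hy : (freeLift (C := F) id).toFun y = 0)
    (hyJ : y ∈ idealSpan J (id : free R F → free R F)) :
    y ∈ idealSpan J
      (Subtype.val : {b : free R F // (freeLift (C := F) id).toFun b = 0} → free R F) := by
  have := isDiscreteModule_quotient hJ
  let Q := standardResolution F
  obtain ⟨z, rfl⟩ := (Q.exact_zero y).1 hy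
  -- The image of `z` is `y ∈ J P₀`, so `1 ⊙ z` is a 1-cycle, and therefore a boundary.
  have hz : Contratensor.map (R ⧸ J) (Q.d 0) (oneTensor J _ z) = 0 := by
    rw [map_oneTensor]
    exact oneTensor_eq_zero_of_mem hyJ
  have hsub : Subsingleton (Q.homology (R ⧸ J) 1) := hF (R ⧸ J)
  have hzero : (QuotientAddGroup.mk
      (⟨oneTensor J _ z, hz⟩ : Q.cycles (R ⧸ J) 1) : Q.homology (R ⧸ J) 1) = 0 :=
    hsub.elim _ _
  obtain ⟨t, ht⟩ := (QuotientAddGroup.eq_zero_iff _).1 hzero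
  obtain ⟨w, rfl⟩ := oneTensor_surjective (J := J) _ t
  have hzw : oneTensor J _ (z - (Q.d 1).toFun w) = 0 := by
    rw [_root_.map_sub, sub_eq_zero, ← map_oneTensor]
    exact ht.symm
  -- Correcting `z` by a boundary puts it in `J P₁` without changing its image `y`; that image is
  -- then a `J`-combination of values of `d 0`, all in the kernel.
  have hmem := map_mem_idealSpan (Q.d 0) (mem_of_oneTensor_eq_zero hJ hzw)
  rw [Hom.map_sub, (Q.exact_succ 0 _).2 ⟨w, rfl⟩, sub_zero] at hmem
  exact idealSpan_comp_le hJ Subtype.val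
    (fun x => ⟨(Q.d 0).toFun x, (Q.exact_zero _).2 ⟨x, rfl⟩⟩) hmem

end Cyclic

/-! ## Projective covers of flat contramodules -/

theorem epi_of_surjective {C D : Contramodule R} (f : C ⟶ D) (hf : Function.Surjective f.toFun) :
    Epi f :=
  ⟨fun g h hgh => hom_ext fun d => by
    obtain ⟨c, rfl⟩ := hf d
    exact congrArg (fun k : C ⟶ _ => k.toFun c) hgh⟩

/-- The inverse map respects contraactions, as is seen after applying the injective `f`. -/
theorem isIso_of_bijective {C D : Contramodule R} (f : C ⟶ D)
    (hf : Function.Bijective f.toFun) : IsIso f := by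
  let e := Equiv.ofBijective f.toFun hf
  have he : f.toFun ∘ e.symm = id := funext e.apply_symm_apply
  refine ⟨⟨e.symm, fun r => hf.1 ?_⟩, hom_ext e.symm_apply_apply, hom_ext e.apply_symm_apply⟩
  rw [f.map_contra, map_map, he, map_id]
  exact e.apply_symm_apply _

theorem freeLift_mem_ker {X : Type u} {C D : Contramodule R} (p : C ⟶ D) {g : X → C}
    (hg : ∀ x, p.toFun (g x) = 0) (a : free R X) : p.toFun ((freeLift g).toFun a) = 0 := by
  have h : ∀ a : FormalSum R X, p.toFun (C.contra (map g a)) = 0 := fun a => by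
    rw [p.map_contra, map_map, show p.toFun ∘ g = fun _ => 0 from funext hg,
      Contramodule.contra_map_zero]
  exact h a

/-- Modulo sums with coefficients in the open right ideal `I`, an element `∑ aₓ x` of the kernel
of `R[[F]] ⟶ F` is a finite sum `∑ aₓ cₓ` with `cₓ` in the kernel. -/
theorem exists_finite_sum_ker {F : Contramodule R} (hF : IsOneStrictlyFlat F)
    {I : Submodule Rᵐᵒᵖ R} (hI : IsOpen (I : Set R)) (a : free R F)
    (ha : (freeLift (C := F) id).toFun a = 0) (T : Finset F) (hT : ∀ x, a.1 x ∉ I → x ∈ T) :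
    ∃ c : F → free R F, (∀ x, (freeLift (C := F) id).toFun (c x) = 0) ∧
      a - ∑ x ∈ T, a.1 x • c x ∈ idealSpan I (id : free R F → free R F) := by
  classical
  -- `J` contains every coefficient of `a`, is open because it contains `I`, and is finitely
  -- generated modulo `I`.
  let J : Submodule Rᵐᵒᵖ R := I ⊔ Submodule.span Rᵐᵒᵖ (a.1 '' T)
  have hIJ : I ≤ J := le_sup_left
  have hJ : IsOpen (J : Set R) :=
    AddSubgroup.isOpen_mono (H₁ := I.toAddSubgroup) (H₂ := J.toAddSubgroup) hIJ hI
  have haJ : ∀ x, a.1 x ∈ J := fun x => by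
    by_cases hx : a.1 x ∈ I
    · exact hIJ hx
    · exact (le_sup_right : _ ≤ J) (Submodule.subset_span ⟨x, hT x hx, rfl⟩)
  have haspan : a ∈ idealSpan J (id : free R F → free R F) := by
    refine idealSpan_le_id hJ (fun x : F => (show free R F from point x)) ⟨a, haJ, ?_⟩
    exact (join_map (point (R := R) (X := F)) a).trans (bind_point a)
  obtain ⟨j, hj, hja⟩ := mem_idealSpan_ker hF hJ ha haspan
  -- Each coefficient of `a = ∑ j_κ κ` is expanded in the generators `aₓ` of `J` modulo `I`.
  have hdec : ∀ κ, ∃ s : F → R, j.1 κ - ∑ x ∈ T, a.1 x * s x ∈ I := fun κ => by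
    obtain ⟨i, hi, b, hb, hib⟩ := Submodule.mem_sup.1 (hj κ)
    obtain ⟨s, hs⟩ := (Submodule.mem_span_image_finset_iff_exists_fun' Rᵐᵒᵖ).1 hb
    refine ⟨fun x => (s x).unop, ?_⟩
    have hb' : ∑ x ∈ T, a.1 x * (s x).unop = b := hs
    rw [hb', ← hib, add_sub_cancel_right]
    exact hi
  choose s hs using hdec
  have hfin := FormalSum.finite j I hI
  -- `cₓ` gathers what multiplies `aₓ` on the right. Only the finitely many `κ` with `j_κ ∉ I` are
  -- kept, so no convergence of `s κ x` in `κ` is needed.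
  refine ⟨fun x => ∑ κ ∈ hfin.toFinset, s κ x • κ.1, fun x => ?_, ?_⟩
  · rw [Hom.map_sum]
    exact Finset.sum_eq_zero fun κ _ => by rw [Hom.map_smul, κ.2, smul_zero]
  -- The error has two parts: the terms with `j_κ ∈ I` (`h1`) and the errors of the expansions of
  -- the finitely many other `j_κ` (`h2`).
  · have h1 := idealSpan_le_id hI _ (contra_map_sub_sum_mem (J := I) (C := free R F)
      (Subtype.val : {b : free R F // (freeLift (C := F) id).toFun b = 0} → free R F) j
      hfin.toFinset fun κ hκ => hfin.mem_toFinset.2 hκ)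
    have h2 : ∑ κ ∈ hfin.toFinset, (j.1 κ - ∑ x ∈ T, a.1 x * s κ x) • κ.1
        ∈ idealSpan I (id : free R F → free R F) :=
      sum_mem fun κ _ => smul_mem_idealSpan (id : free R F → free R F) (hs κ) κ.1
    have h3 := add_mem h1 h2
    have hja' : (free R F).contra (map Subtype.val j) = a := hja
    rw [hja'] at h3
    convert h3 using 1
    simp only [sub_smul, Finset.sum_smul, Finset.sum_sub_distrib, Finset.smul_sum, mul_smul]
    rw [Finset.sum_comm]
    abel

/-- The kernel of `p` lies in `I P` for every open right ideal `I`, and a retract of a free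
contramodule has no nonzero element with this property. -/
theorem IsProjectiveCover.injective {F P : Contramodule R} (hF : IsOneStrictlyFlat F)
    {p : P ⟶ F} (hp : IsProjectiveCover p) : Function.Injective p.toFun := by
  classical
  have := hp.projective
  have := hp.epi
  let q : free R F ⟶ F := freeLift id
  have : Epi q := epi_of_surjective q fun c => ⟨point c, freeLift_point _ _⟩
  let u : P ⟶ free R F := Projective.factorThru p q
  let v : free R F ⟶ P := Projective.factorThru q p
  have hu : u ≫ q = p := Projective.factorThru_comp p q
  have hv : v ≫ p = q := Projective.factorThru_comp q p
  have hu' : ∀ x, q.toFun (u.toFun x) = p.toFun x := fun x =>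
    congrArg (fun f : P ⟶ F => f.toFun x) hu
  have hv' : ∀ x, p.toFun (v.toFun x) = q.toFun x := fun x =>
    congrArg (fun f : free R F ⟶ F => f.toFun x) hv
  have : IsIso (u ≫ v) := hp.isIso_of_comp_eq _ (by rw [Category.assoc, hv, hu])
  have hmem : ∀ k, p.toFun k = 0 → ∀ I : Submodule Rᵐᵒᵖ R, IsOpen (I : Set R) →
      k ∈ idealSpan I (id : P → P) := by
    intro k hk I hI
    let a : free R F := u.toFun k
    have hfin := FormalSum.finite a I hI
    have hT : ∀ x, a.1 x ∉ I → x ∈ hfin.toFinset := fun x hx => hfin.mem_toFinset.2 hx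
    obtain ⟨c, hc, hac⟩ := exists_finite_sum_ker hF hI a ((hu' k).trans hk) _ hT
    let g : F → P := fun x => v.toFun (c x)
    have hg : ∀ x, p.toFun (g x) = 0 := fun x => (hv' _).trans (hc x)
    -- The subtracted map is defined on all of `P` and takes values in the kernel of `p`, so `e` is
    -- again an endomorphism over `p`. At `k` it cancels `v a` modulo `I P`.
    let e : P ⟶ P := Hom.sub (u ≫ v) (u ≫ freeLift g)
    have he : e ≫ p = p := hom_ext fun x => by
      change p.toFun (v.toFun (u.toFun x) - (freeLift g).toFun (u.toFun x)) = p.toFun x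
      rw [Hom.map_sub, freeLift_mem_ker p hg, sub_zero, hv', hu']
    have := hp.isIso_of_comp_eq e he
    have h1 := idealSpan_le_id hI _ (map_mem_idealSpan v hac)
    have h2 := idealSpan_le_id hI _ (contra_map_sub_sum_mem (J := I) g a _ hT)
    -- Both `v a` and `∑ aₓ g(x)` agree modulo `I P` with the same finite sum over `x ∈ T`.
    have hek : e.toFun k ∈ idealSpan I (id : P → P) := by
      have h3 := sub_mem h1 h2
      rw [Hom.map_sub, Hom.map_sum] at h3
      simp only [Hom.map_smul] at h3
      rw [sub_sub_sub_cancel_right] at h3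
      exact h3
    -- Although `e` depends on `I` and `k`, its inverse is a contramodule morphism and preserves `I
    -- P`.
    have h4 := idealSpan_le_id hI _ (map_mem_idealSpan (inv e) hek)
    rwa [← comp_toFun, IsIso.hom_inv_id, id_toFun] at h4
  have hcoord : ∀ k, p.toFun k = 0 → u.toFun k = (0 : FormalSum R F) := fun k hk =>
    Subtype.ext (funext fun x => eq_zero_of_forall_mem_isOpen fun I hI =>
      coeff_mem_of_mem_idealSpan hI
        (idealSpan_le_id hI _ (map_mem_idealSpan u (hmem k hk I hI))) x)
  have hinj : ∀ x y, u.toFun x = u.toFun y → x = y := fun x y h => by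
    have h' : (inv (u ≫ v)).toFun ((u ≫ v).toFun x) = (inv (u ≫ v)).toFun ((u ≫ v).toFun y) := by
      rw [comp_toFun u v, comp_toFun u v, h]
    rwa [← comp_toFun, ← comp_toFun, IsIso.hom_inv_id, id_toFun, id_toFun] at h'
  intro x y hxy
  rw [← sub_eq_zero]
  refine hinj _ _ ?_
  rw [hcoord (x - y) (by rw [Hom.map_sub, hxy, sub_self]), hcoord 0 (Hom.map_zero p)]

end ContraactionOfIdeals

end

end Contra

theorem proposition3p4 {R : Type u} [Ring R] [UniformSpace R] [IsUniformAddGroup R]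
    [IsTopologicalRing R] [CompleteSpace R] [T2Space R] [IsLinearTopology Rᵐᵒᵖ R]
    (hR : (𝓝 (0 : R)).HasBasis (fun I : TwoSidedIdeal R => IsOpen (I : Set R))
      (fun I : TwoSidedIdeal R => (I : Set R)))
    (F : Contra.Contramodule R) (hF : Contra.IsOneStrictlyFlat F)
    (P : Contra.Contramodule R) (p : P ⟶ F) (hp : Contra.IsProjectiveCover p) :
    IsIso p ∧ Projective F := by
  have := hp.epi
  have : IsIso p := Contra.isIso_of_bijective p
    ⟨hp.injective hF, Contra.surjective_of_epi p⟩
  exact ⟨inferInstance, Projective.of_iso (asIso p) hp.projective⟩
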